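/- For integers $n,k\ge 1$ let $C_k\wr S_n$ denote the generalised symmetric group, regarded as the subgroup of $GL_n(\mathbb{C})$ of all matrices that have exactly one non-zero entry in each row and each column, every non-zero entry being a $k$-th root of unity. Let $V=\mathbb{C}^n$ be its natural representation, let $\chi_r$ be the character of the $r$-th symmetric power $\mathrm{Sym}^rV$ ($r\ge 0$), and let $$D(n,k)=\dim\,\mathrm{Span}_{\mathbb{C}}\{\chi_r : r\ge 0\}.$$ Then there is an absolute constant $c>0$ such that for all integers $n\ge 2$ and $k\ge 1$, $$D(n,k)\ \ge\ \max\Bigl(\tfrac{n^2}{2}-c\,n^{3/2},\ \ k\bigl((n-1)\log(n-1)-2(n-2)\bigr)\Bigr).$$ -/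

import Mathlib

namespace GenSymm

/-- `A` is a monomial matrix whose non-zero entries are `k`-th roots of unity: each row and each
column has exactly one non-zero entry, and every non-zero entry `z` satisfies `z ^ k = 1`. -/
structure IsGenPermMatrix {n : ℕ} (k : ℕ) (A : Matrix (Fin n) (Fin n) ℂ) : Prop where
  root : ∀ i j, A i j ≠ 0 → A i j ^ k = 1
  row : ∀ i, ∃! j, A i j ≠ 0
  col : ∀ j, ∃! i, A i j ≠ 0

theorem IsGenPermMatrix.one (n k : ℕ) :
    IsGenPermMatrix k (1 : Matrix (Fin n) (Fin n) ℂ) where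
  root i j h := by
    by_cases hij : i = j
    · subst hij
      rw [Matrix.one_apply_eq, one_pow]
    · exact absurd (Matrix.one_apply_ne hij) h
  row i := ⟨i, by simp, fun j hj => by
    by_contra h
    exact hj (Matrix.one_apply_ne (Ne.symm h))⟩
  col j := ⟨j, by simp, fun i hi => by
    by_contra h
    exact hi (Matrix.one_apply_ne h)⟩

theorem IsGenPermMatrix.mul {n k : ℕ} {A B : Matrix (Fin n) (Fin n) ℂ}
    (hA : IsGenPermMatrix k A) (hB : IsGenPermMatrix k B) : IsGenPermMatrix k (A * B) := by
  choose a ha ha' using hA.row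
  choose b hb hb' using hB.row
  choose a₂ ha₂ ha₂' using hA.col
  choose b₂ hb₂ hb₂' using hB.col
  have key : ∀ i j, (A * B) i j = A i (a i) * B (a i) j := by
    intro i j
    rw [Matrix.mul_apply]
    refine Finset.sum_eq_single (a i) (fun l _ hl => ?_) (by simp)
    have : A i l = 0 := by
      by_contra h
      exact hl (ha' i l h)
    simp [this]
  refine ⟨fun i j h => ?_, fun i => ⟨b (a i), ?_, fun j hj => ?_⟩,
    fun j => ⟨a₂ (b₂ j), ?_, fun i hi => ?_⟩⟩
  · rw [key] at h ⊢
    rw [mul_pow, hA.root _ _ (left_ne_zero_of_mul h), hB.root _ _ (right_ne_zero_of_mul h), one_mul]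
  · simp only [key]
    exact mul_ne_zero (ha i) (hb (a i))
  · simp only [key] at hj
    exact hb' _ _ (right_ne_zero_of_mul hj)
  · simp only [key]
    have h : b₂ j = a (a₂ (b₂ j)) := ha' _ _ (ha₂ (b₂ j))
    refine mul_ne_zero (ha _) ?_
    rw [← h]
    exact hb₂ j
  · simp only [key] at hi
    have h : a i = b₂ j := hb₂' _ _ (right_ne_zero_of_mul hi)
    exact ha₂' _ _ (by rw [← h]; exact ha i)

theorem IsGenPermMatrix.of_mul_eq_one {n k : ℕ} {A B : Matrix (Fin n) (Fin n) ℂ}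
    (hA : IsGenPermMatrix k A) (h : A * B = 1) : IsGenPermMatrix k B := by
  choose a ha ha' using hA.row
  choose a₂ ha₂ ha₂' using hA.col
  have key : ∀ i j, A i (a i) * B (a i) j = (1 : Matrix (Fin n) (Fin n) ℂ) i j := by
    intro i j
    rw [← h, Matrix.mul_apply]
    symm
    refine Finset.sum_eq_single (a i) (fun l _ hl => ?_) (by simp)
    have : A i l = 0 := by
      by_contra h'
      exact hl (ha' i l h')
    simp [this]
  have haa : ∀ l, a (a₂ l) = l := fun l => (ha' _ _ (ha₂ l)).symm
  have haa' : ∀ i, a₂ (a i) = i := fun i => (ha₂' _ _ (ha i)).symm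
  have zero : ∀ l j, B l j ≠ 0 → a₂ l = j := by
    intro l j hB
    by_contra hne
    have := key (a₂ l) j
    rw [haa, Matrix.one_apply_ne hne] at this
    exact (mul_ne_zero (ha₂ l) hB) this
  have val : ∀ l, A (a₂ l) l * B l (a₂ l) = 1 := by
    intro l
    have := key (a₂ l) (a₂ l)
    rwa [haa, Matrix.one_apply_eq] at this
  have nz : ∀ l, B l (a₂ l) ≠ 0 := fun l => right_ne_zero_of_mul_eq_one (val l)
  refine ⟨fun l j hB => ?_, fun l => ⟨a₂ l, nz l, fun j hj => (zero l j hj).symm⟩,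
    fun j => ⟨a j, ?_, fun l hl => ?_⟩⟩
  · obtain rfl := zero l j hB
    have := congrArg (· ^ k) (val l)
    simpa [mul_pow, hA.root _ _ (ha₂ l)] using this
  · have := nz (a j)
    rwa [haa'] at this
  · rw [← zero l j hl, haa]

/-- The generalised symmetric group `C_k ≀ S_n`, as the subgroup of `GL_n(ℂ)` of the matrices with
exactly one non-zero entry in each row and each column, these entries being `k`-th roots of
unity. -/
def genSymmGroup (n k : ℕ) : Subgroup (Matrix.GeneralLinearGroup (Fin n) ℂ) where
  carrier := {g | IsGenPermMatrix k (g : Matrix (Fin n) (Fin n) ℂ)}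
  one_mem' := IsGenPermMatrix.one n k
  mul_mem' hg hh := IsGenPermMatrix.mul hg hh
  inv_mem' {g} hg := IsGenPermMatrix.of_mul_eq_one hg g.mul_inv

/-- The natural representation of `C_k ≀ S_n` on `V = ℂ^n`: a matrix acts on column vectors. -/
noncomputable def natRep (n k : ℕ) : Representation ℂ (genSymmGroup n k) (Fin n → ℂ) :=
  ((Matrix.toLinAlgEquiv' : Matrix (Fin n) (Fin n) ℂ ≃ₐ[ℂ] _) :
      Matrix (Fin n) (Fin n) ℂ →* ((Fin n → ℂ) →ₗ[ℂ] (Fin n → ℂ))).comp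
    ((Units.coeHom (Matrix (Fin n) (Fin n) ℂ)).comp (genSymmGroup n k).subtype)

section Sym

variable {V : Type*} [AddCommGroup V] [Module ℂ V]

/-- The `r`-th symmetric power `Sym^r V`, as the degree `r` component of the symmetric algebra of
`V`, i.e. the span of the products of `r` vectors of `V`. -/
noncomputable def symPow (V : Type*) [AddCommGroup V] [Module ℂ V] (r : ℕ) :
    Submodule ℂ (SymmetricAlgebra ℂ V) :=
  LinearMap.range (SymmetricAlgebra.ι ℂ V) ^ r

/-- The algebra endomorphism of the symmetric algebra of `V` induced by an endomorphism of `V`: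
`v₁ ⋯ v_r ↦ f v₁ ⋯ f v_r`. -/
noncomputable def symMap (f : V →ₗ[ℂ] V) : SymmetricAlgebra ℂ V →ₐ[ℂ] SymmetricAlgebra ℂ V :=
  SymmetricAlgebra.lift (SymmetricAlgebra.ι ℂ V ∘ₗ f)

theorem symMap_ι (f : V →ₗ[ℂ] V) (v : V) :
    symMap f (SymmetricAlgebra.ι ℂ V v) = SymmetricAlgebra.ι ℂ V (f v) := by
  simp [symMap]

theorem symMap_one : symMap (1 : V →ₗ[ℂ] V) = AlgHom.id ℂ _ := by
  apply SymmetricAlgebra.algHom_ext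
  ext v
  simp [symMap_ι]

theorem symMap_mul (f g : V →ₗ[ℂ] V) : symMap (f * g) = (symMap f).comp (symMap g) := by
  apply SymmetricAlgebra.algHom_ext
  ext v
  simp [symMap_ι]

theorem symMap_mem (f : V →ₗ[ℂ] V) (r : ℕ) :
    ∀ x ∈ symPow V r, (symMap f).toLinearMap x ∈ symPow V r := by
  intro x hx
  have h : (symPow V r).map (symMap f).toLinearMap ≤ symPow V r := by
    unfold symPow
    rw [Submodule.map_pow]
    refine pow_le_pow_left' ?_ r
    rintro _ ⟨_, ⟨v, rfl⟩, rfl⟩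
    exact ⟨f v, (symMap_ι f v).symm⟩
  exact h (Submodule.mem_map_of_mem hx)

/-- The `r`-th symmetric power of a representation:
`g • (v₁ ⋯ v_r) = (g • v₁) ⋯ (g • v_r)`. -/
noncomputable def symPowRep {G : Type*} [Group G] (ρ : Representation ℂ G V) (r : ℕ) :
    Representation ℂ G (symPow V r) where
  toFun g := (symMap (ρ g)).toLinearMap.restrict (symMap_mem (ρ g) r)
  map_one' := by
    ext x
    simp [symMap_one]
  map_mul' g h := by
    ext x
    simp [symMap_mul]

end Sym

/-- The character `χ_r` of the `r`-th symmetric power of the natural representation of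
`C_k ≀ S_n`. -/
noncomputable def chi (n k r : ℕ) : genSymmGroup n k → ℂ :=
  (symPowRep (natRep n k) r).character

/-- `D(n, k)`: the dimension of the space of functions on `C_k ≀ S_n` spanned by the characters
`χ_0, χ_1, χ_2, …`. -/
noncomputable def D (n k : ℕ) : ℕ :=
  Module.finrank ℂ (Submodule.span ℂ (Set.range (chi n k)))

end GenSymm

/-! The character `χ_r` is not in the span of the `χ_s` with `s < r` as soon as some polynomial `v`
of degree `r` in `n` variables spans a line whose stabiliser in `C_k ≀ S_n` acts on it by a
character that occurs on no polynomial of lower degree: the multiplicity of that character is a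
linear functional of the class functions, and it vanishes on all `χ_s` with `s < r` but not on
`χ_r` (`exists_functional_of_eigenvector`). Degrees with this property index linearly independent
characters (`card_le_finrank_span_of_functionals`).

Such a polynomial is obtained from a partition `λ` of `n - 1` and a residue `0 ≤ s < k`: split all
variables but one into blocks of sizes `λ_i`, and multiply the Vandermonde determinants of the
`x_j ^ k` over the blocks by the `s`-th power of the remaining variable. Its degree is
`k ∑ C(λ_i, 2) + s`, and this is minimal: a polynomial that transforms in the same way under the
diagonal matrices has only exponents divisible by `k` in the blocks and congruent to `s` at the
remaining variable, and antisymmetry under the transpositions makes the exponents in a block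
distinct (`exists_functional_of_colouring`, `exists_functional_of_partition`). Consequently
`D(n, k)` is at least `k` times the number of values of `∑ C(λ_i, 2)` over partitions of `n - 1`
(`mul_card_binomSums_le_D`).

It remains to find enough values. Taking `λ = (a, b, 2^w, 1, …, 1)` greedily, all numbers up to
`n² / 2 - O(n^{3/2})` are values (`isBinomSum_of_lt`), which is the first bound. The partitions
`(d, 2^w, 1, …, 1)` of `m` with `w < d` alone give `m² / 6` values (`sq_le_card_binomSums`), which
exceeds `m log m - 2 (m - 1)` for every `m ≥ 1`; with `m = n - 1` this is the second bound. -/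

/-! ### Separating characters by linear functionals -/

section Functional

variable {G : Type*} [Group G]

open Classical in
/-- The scalar by which `g` acts on the vector `v`, and `0` when `v` is not an eigenvector
of `g`. -/
noncomputable def eigenScalar {V : Type*} [AddCommGroup V] [Module ℂ V]
    (ρ : Representation ℂ G V) (v : V) (g : G) : ℂ :=
  if h : ∃ c : ℂ, ρ g v = c • v then h.choose else 0

section Eigen

variable {V : Type*} [AddCommGroup V] [Module ℂ V] {ρ : Representation ℂ G V} {v : V}

theorem eigenScalar_eq (hv : v ≠ 0) {g : G} {c : ℂ} (h : ρ g v = c • v) :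
    eigenScalar ρ v g = c := by
  have hex : ∃ c : ℂ, ρ g v = c • v := ⟨c, h⟩
  rw [eigenScalar, dif_pos hex]
  exact smul_left_injective ℂ hv (hex.choose_spec.symm.trans h)

theorem eigenScalar_eq_zero {g : G} (h : ¬ ∃ c : ℂ, ρ g v = c • v) : eigenScalar ρ v g = 0 := by
  rw [eigenScalar, dif_neg h]

theorem eigenScalar_one (hv : v ≠ 0) : eigenScalar ρ v 1 = 1 :=
  eigenScalar_eq hv (by simp)

theorem eigenScalar_mul_right (hv : v ≠ 0) (g : G) {h : G} {c : ℂ} (hh : ρ h v = c • v) :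
    eigenScalar ρ v (g * h) = c * eigenScalar ρ v g := by
  have hc : c ≠ 0 := by
    rintro rfl
    apply hv
    rw [zero_smul] at hh
    simpa [← Module.End.mul_apply, ← map_mul] using congrArg (ρ h⁻¹) hh
  by_cases hg : ∃ d : ℂ, ρ g v = d • v
  · obtain ⟨d, hd⟩ := hg
    rw [eigenScalar_eq hv hd]
    refine eigenScalar_eq hv ?_
    rw [map_mul, Module.End.mul_apply, hh, map_smul, hd, smul_smul]
  · rw [eigenScalar_eq_zero hg, mul_zero]
    refine eigenScalar_eq_zero ?_
    rintro ⟨d, hd⟩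
    refine hg ⟨c⁻¹ * d, ?_⟩
    rw [map_mul, Module.End.mul_apply, hh, map_smul] at hd
    rw [mul_smul, ← hd, smul_smul, inv_mul_cancel₀ hc, one_smul]

end Eigen

/-- A vector `v` of `W r` whose eigencharacter (on the stabiliser of the line of `v`) does not
occur in any `W s` with `s < r` yields a linear functional that separates the character of `W r`
from those of all `W s` with `s < r`: up to a scalar, it is the multiplicity of the
eigencharacter. -/
theorem exists_functional_of_eigenvector [Finite G] {W : ℕ → Type*} [∀ s, AddCommGroup (W s)]
    [∀ s, Module ℂ (W s)] [∀ s, Module.Finite ℂ (W s)] (ρ : ∀ s, Representation ℂ G (W s))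
    (r : ℕ) (v : W r) (hv : v ≠ 0)
    (h : ∀ s < r, ∀ w : W s, (∀ (g : G) (c : ℂ), ρ r g v = c • v → ρ s g w = c • w) → w = 0) :
    ∃ ℓ : (G → ℂ) →ₗ[ℂ] ℂ, (∀ s < r, ℓ (ρ s).character = 0) ∧ ℓ (ρ r).character ≠ 0 := by
  have := Fintype.ofFinite G
  set e := eigenScalar (ρ r) v with he
  let Q : ∀ s, W s →ₗ[ℂ] W s := fun s => ∑ g, e g⁻¹ • ρ s g
  let ℓ : (G → ℂ) →ₗ[ℂ] ℂ := ∑ g, e g⁻¹ • LinearMap.proj g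
  have hℓ : ∀ s, ℓ (ρ s).character = LinearMap.trace ℂ _ (Q s) := by
    intro s
    simp [ℓ, Q, Representation.character]
  -- `Q s` maps into the eigenspace of the character `e` of the stabiliser of the line of `v`
  have hQ : ∀ s (g : G) (c : ℂ), ρ r g v = c • v → ρ s g * Q s = c • Q s := by
    intro s g c hg
    simp only [Q, Finset.mul_sum, Finset.smul_sum, mul_smul_comm, ← map_mul, smul_smul]
    refine Fintype.sum_equiv (Equiv.mulLeft g) _ _ fun x => ?_
    rw [Equiv.coe_mulLeft, ← eigenScalar_mul_right hv _ hg]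
    simp [he]
  have hee : ∀ (g : G) (c : ℂ), ρ r g v = c • v → e g⁻¹ * c = 1 := by
    intro g c hg
    rw [mul_comm, ← eigenScalar_mul_right hv _ hg, inv_mul_cancel, eigenScalar_one hv]
  have hN : ∀ g : G, e g⁻¹ * e g = if e g = 0 then 0 else 1 := by
    intro g
    split_ifs with h0
    · rw [h0, mul_zero]
    · have hg : ∃ c : ℂ, ρ r g v = c • v := by
        by_contra hcon
        exact h0 (eigenScalar_eq_zero hcon)
      obtain ⟨c, hg⟩ := hg
      rw [he, eigenScalar_eq hv hg]
      exact hee g c hg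
  -- `e g⁻¹` vanishes off the stabiliser of the line of `v`, as it is a subgroup
  have hsupp : ∀ g : G, e g⁻¹ ≠ 0 → ρ r g v = e g • v := by
    intro g hg
    have hg' : ∃ c : ℂ, ρ r g⁻¹ v = c • v := by
      by_contra hcon
      exact hg (eigenScalar_eq_zero hcon)
    obtain ⟨c, hc⟩ := hg'
    have h1 := eigenScalar_mul_right hv g hc
    rw [mul_inv_cancel, eigenScalar_one hv] at h1
    by_contra hcon
    have h2 : ¬ ∃ d : ℂ, ρ r g v = d • v := by
      rintro ⟨d, hd⟩
      exact hcon (by rw [he, eigenScalar_eq hv hd, hd])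
    rw [eigenScalar_eq_zero h2, mul_zero] at h1
    exact one_ne_zero h1
  -- `N` is the order of the stabiliser; `N⁻¹ • Q r` is an idempotent fixing `v`
  set N : ℂ := ∑ g, e g⁻¹ * e g with hNdef
  have hN0 : N ≠ 0 := by
    rw [hNdef]
    simp only [hN, Finset.sum_ite, Finset.sum_const_zero, zero_add, Finset.sum_const,
      nsmul_eq_mul, mul_one, Nat.cast_ne_zero]
    refine Finset.card_ne_zero_of_mem (a := 1) ?_
    simp [he, eigenScalar_one hv]
  have hQv : Q r v = N • v := by
    simp only [Q, LinearMap.sum_apply, LinearMap.smul_apply, hNdef, Finset.sum_smul]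
    refine Finset.sum_congr rfl fun g _ => ?_
    by_cases h0 : e g⁻¹ = 0
    · simp [h0]
    · rw [hsupp g h0, smul_smul]
  have hQQ : Q r * Q r = N • Q r := by
    conv_lhs => enter [1]; simp only [Q]
    simp only [Finset.sum_mul, hNdef, Finset.sum_smul, smul_mul_assoc]
    refine Finset.sum_congr rfl fun g _ => ?_
    by_cases h0 : e g⁻¹ = 0
    · simp [h0]
    · rw [hQ r g _ (hsupp g h0), smul_smul]
  refine ⟨ℓ, fun s hs => ?_, ?_⟩
  · have : Q s = 0 := by
      ext w
      refine h s hs _ fun g c hg => ?_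
      exact LinearMap.congr_fun (hQ s g c hg) w
    rw [hℓ, this, map_zero]
  · rw [hℓ]
    intro h0
    have hidem : IsIdempotentElem (N⁻¹ • Q r) := by
      rw [IsIdempotentElem, smul_mul_smul_comm, hQQ, smul_smul, mul_assoc, inv_mul_cancel₀ hN0,
        mul_one]
    have hz := LinearMap.IsIdempotentElem.eq_zero_of_trace_eq_zero hidem
      (by rw [map_smul, h0, smul_zero])
    have h1 : (N⁻¹ • Q r) v = v := by
      rw [LinearMap.smul_apply, hQv, smul_smul, inv_mul_cancel₀ hN0, one_smul]
    rw [hz] at h1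
    exact hv h1.symm

end Functional

/-- Triangularity: vectors that are separated from all their predecessors by linear functionals
are linearly independent. -/
theorem card_le_finrank_span_of_functionals {M : Type*} [AddCommGroup M] [Module ℂ M]
    [Module.Finite ℂ M] (f : ℕ → M) (R : Finset ℕ)
    (h : ∀ r ∈ R, ∃ ℓ : M →ₗ[ℂ] ℂ, (∀ s < r, ℓ (f s) = 0) ∧ ℓ (f r) ≠ 0) :
    R.card ≤ Module.finrank ℂ (Submodule.span ℂ (Set.range f)) := by
  have hli : LinearIndependent ℂ fun r : R => f r := by
    rw [Fintype.linearIndependent_iff]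
    intro g hg
    by_contra! hne
    have hne' : (Finset.univ.filter fun r : R => g r ≠ 0).Nonempty := by
      simpa [Finset.filter_nonempty_iff] using hne
    obtain ⟨r, hr, hmax⟩ := Finset.exists_max_image _ (fun r : R => (r : ℕ)) hne'
    obtain ⟨ℓ, h0, h1⟩ := h r r.2
    have := congrArg ℓ hg
    rw [map_sum, map_zero, Finset.sum_eq_single r] at this
    · rw [map_smul, smul_eq_mul] at this
      exact mul_ne_zero (Finset.mem_filter.1 hr).2 h1 this
    · intro s _ hs
      rw [map_smul, smul_eq_mul]
      rcases lt_or_gt_of_ne (fun h => hs (Subtype.ext h) : (s : ℕ) ≠ r) with hlt | hgt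
      · rw [h0 s hlt, mul_zero]
      · have : g s = 0 := by
          by_contra hgs
          exact absurd (hmax s (by simpa using hgs)) (not_le.2 hgt)
        rw [this, zero_mul]
    · simp
  have := (linearIndependent_span (hs := hli)).fintype_card_le_finrank
  rw [Fintype.card_coe] at this
  refine this.trans (Submodule.finrank_mono (Submodule.span_mono ?_))
  rintro _ ⟨r, rfl⟩
  exact ⟨r, rfl⟩

/-! ### The numbers `∑ C(λ_i, 2)` -/

/-- `v` is of the form `∑ C(λ_i, 2)` for a partition `λ = (a, b, 2^w, 1, …, 1)` of `m`; `a` and `b`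
may be `0`, and the parts equal to `1`, which do not contribute, fill up the slack in the
inequality. -/
def IsBinomSum (m v : ℕ) : Prop :=
  ∃ a b w : ℕ, a + b + 2 * w ≤ m ∧ v = a.choose 2 + b.choose 2 + w

theorem choose_two_succ (a : ℕ) : (a + 1).choose 2 = a + a.choose 2 := by
  rw [Nat.choose_succ_succ' a 1, Nat.choose_one_right]

/-- Greedy decomposition: `v` is a triangular number plus a remainder smaller than its side. -/
theorem exists_eq_choose_two_add (v : ℕ) : ∃ a w, w ≤ a ∧ v = (a + 1).choose 2 + w := by
  induction v with
  | zero => exact ⟨0, 0, le_rfl, rfl⟩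
  | succ v ih =>
    obtain ⟨a, w, hw, rfl⟩ := ih
    rcases hw.lt_or_eq with h | rfl
    · exact ⟨a, w + 1, h, rfl⟩
    · refine ⟨w + 1, 0, Nat.zero_le _, ?_⟩
      rw [choose_two_succ (w + 1)]
      omega

theorem choose_two_add_lt {a b w : ℕ} (hw : w < a) (hab : a < b) :
    a.choose 2 + w < b.choose 2 := by
  have h1 := choose_two_succ a
  have h2 : (a + 1).choose 2 ≤ b.choose 2 := Nat.choose_le_choose 2 hab
  omega

theorem choose_two_add_inj {a b w x : ℕ} (hw : w < a) (hx : x < b)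
    (h : a.choose 2 + w = b.choose 2 + x) : a = b ∧ w = x := by
  rcases lt_trichotomy a b with hab | rfl | hab
  · have := choose_two_add_lt hw hab
    omega
  · exact ⟨rfl, by omega⟩
  · have := choose_two_add_lt hx hab
    omega

/-- All numbers below `C(A + 1, 2)` are attained, where `A = m - O(√m)`. -/
theorem isBinomSum_of_lt {m A v : ℕ} (hA : A + 6 * m.sqrt + 3 ≤ m)
    (hv : v < (A + 1).choose 2) : IsBinomSum m v := by
  -- the remainder of the first greedy step is at most `a ≤ m`, so the second side is `O(√m)`
  -- and the last remainder can be made of parts of size `2`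
  obtain ⟨a, w, hw, rfl⟩ := exists_eq_choose_two_add v
  obtain ⟨b, x, hx, rfl⟩ := exists_eq_choose_two_add w
  have ha : a + 1 ≤ A := by
    by_contra! hcon
    have := Nat.choose_le_choose 2 (show A + 1 ≤ a + 1 by omega)
    omega
  have hb : b ≤ 2 * m.sqrt := by
    by_contra! hcon
    have h1 : (b + 1).choose 2 * 2 = (b + 1) * b := by
      have := Nat.triangle_succ b
      rw [Nat.choose_two_right, Nat.add_sub_cancel,
        Nat.div_mul_cancel (by simpa [mul_comm] using (Nat.even_mul_succ_self b).two_dvd)]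
    have h2 := Nat.lt_succ_sqrt m
    rw [Nat.succ_eq_add_one] at h2
    nlinarith
  exact ⟨a + 1, b + 1, x, by omega, by ring⟩

open Classical in
/-- The finite set of all the numbers `IsBinomSum m`; the cut-off `3 m²` loses none of them. -/
noncomputable def binomSums (m : ℕ) : Finset ℕ :=
  (Finset.range (3 * m ^ 2 + 1)).filter (IsBinomSum m)

theorem IsBinomSum.mem_binomSums {m v : ℕ} (h : IsBinomSum m v) : v ∈ binomSums m := by
  classical
  refine Finset.mem_filter.2 ⟨?_, h⟩
  obtain ⟨a, b, w, hm, rfl⟩ := h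
  have h1 := Nat.choose_le_pow a 2
  have h2 := Nat.choose_le_pow b 2
  have h3 : a ^ 2 ≤ m ^ 2 := Nat.pow_le_pow_left (by omega) 2
  have h4 : b ^ 2 ≤ m ^ 2 := Nat.pow_le_pow_left (by omega) 2
  have h5 : w ≤ m ^ 2 := by nlinarith
  rw [Finset.mem_range]
  omega

theorem isBinomSum_of_mem {m v : ℕ} (h : v ∈ binomSums m) : IsBinomSum m v := by
  classical
  exact (Finset.mem_filter.1 h).2

theorem choose_le_card_binomSums {m A : ℕ} (hA : A + 6 * m.sqrt + 3 ≤ m) :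
    (A + 1).choose 2 ≤ (binomSums m).card := by
  rw [← Finset.card_range ((A + 1).choose 2)]
  exact Finset.card_le_card fun v hv =>
    (isBinomSum_of_lt hA (Finset.mem_range.1 hv)).mem_binomSums

/-- The partitions `(d, 2^w, 1, …, 1)` with `w < d` already give `m² / 6` different numbers. -/
theorem sq_le_card_binomSums (m : ℕ) : m ^ 2 ≤ 6 * (binomSums m).card := by
  set q := (m + 2) / 3 with hq
  let T : Finset (Σ _ : ℕ, ℕ) := (Finset.range q).sigma fun w => Finset.range (m - 3 * w)
  have hT : T.card ≤ (binomSums m).card := by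
    refine Finset.card_le_card_of_injOn (fun p => (p.1 + 1 + p.2).choose 2 + p.1) ?_ ?_
    · rintro ⟨w, d⟩ hp
      simp only [T, Finset.coe_sigma, Set.mem_sigma_iff, Finset.mem_coe, Finset.mem_range] at hp
      exact IsBinomSum.mem_binomSums ⟨w + 1 + d, 0, w, by omega, by simp⟩
    · rintro ⟨w, d⟩ - ⟨x, e⟩ - h
      obtain ⟨h1, h2⟩ := choose_two_add_inj (show w < w + 1 + d by omega)
        (show x < x + 1 + e by omega) h
      obtain rfl : w = x := h2
      obtain rfl : d = e := by omega
      rfl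
  -- `∑_{w < p} (m - 3 w) = p m - 3 p (p - 1) / 2`, the subtractions being exact for `p ≤ q`
  have hsum : ∀ p, 3 * p ≤ m + 2 → 2 * ∑ w ∈ Finset.range p, (m - 3 * w) + 3 * p * p
      = 2 * p * m + 3 * p := by
    intro p
    induction p with
    | zero => simp
    | succ p ih =>
      intro hp
      have h1 := ih (by omega)
      rw [Finset.sum_range_succ]
      obtain ⟨u, hu⟩ : ∃ u, m = 3 * p + u := ⟨m - 3 * p, by omega⟩
      have h2 : m - 3 * p = u := by omega
      rw [h2]
      nlinarith
  have hcard : T.card = ∑ w ∈ Finset.range q, (m - 3 * w) := by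
    simp [T]
  have := hsum q (by omega)
  rw [← hcard] at this
  have h1 : m ≤ 3 * q := by omega
  have h2 : 3 * q ≤ m + 2 := by omega
  nlinarith

/-- The second bound, for `m = n - 1` and `k = 1`. -/
theorem log_bound_le_card_binomSums {m : ℕ} (hm : 1 ≤ m) :
    (m : ℝ) * Real.log m - 2 * ((m : ℝ) - 1) ≤ (binomSums m).card := by
  have h6 : ((m : ℝ)) ^ 2 ≤ 6 * (binomSums m).card := by
    exact_mod_cast sq_le_card_binomSums m
  have hm' : (1 : ℝ) ≤ m := by exact_mod_cast hm
  rcases hm.lt_or_eq with h | rfl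
  · have h2 : (2 : ℝ) ≤ m := by exact_mod_cast h
    -- `log 6 < 2`, so the tangent line of `log` at `6` gives `log m ≤ m / 6 + 1`
    have hlog6 : Real.log 6 ≤ 2 := by
      rw [Real.log_le_iff_le_exp (by norm_num)]
      have := Real.exp_one_gt_d9
      have h3 : Real.exp 2 = Real.exp 1 * Real.exp 1 := by
        rw [← Real.exp_add]; norm_num
      nlinarith
    have hlog : Real.log m ≤ m / 6 + 1 := by
      have h3 := Real.log_le_sub_one_of_pos (show (0 : ℝ) < m / 6 by positivity)
      rw [Real.log_div (by positivity) (by norm_num)] at h3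
      linarith
    nlinarith
  · simp

/-- The first bound: with `x = √n` one may take `A ≥ x² - 10 x` in `isBinomSum_of_lt`, and
`A² / 2 ≥ n² / 2 - 10 x³`. -/
theorem sq_bound_le_card_binomSums {n : ℕ} (hn : 2 ≤ n) :
    (n : ℝ) ^ 2 / 2 - 10 * (n : ℝ) ^ (3 / 2 : ℝ) ≤ (binomSums (n - 1)).card := by
  set x := Real.sqrt n with hx
  have hx2 : x ^ 2 = n := Real.sq_sqrt (Nat.cast_nonneg n)
  have hx1 : 1 ≤ x := by
    rw [hx, Real.one_le_sqrt]
    exact_mod_cast (by omega : 1 ≤ n)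
  have hpow : (n : ℝ) ^ (3 / 2 : ℝ) = x ^ 3 := by
    rw [hx, Real.sqrt_eq_rpow, ← Real.rpow_natCast, ← Real.rpow_mul (Nat.cast_nonneg n)]
    norm_num
  rw [hpow, ← hx2]
  have hcard : (0 : ℝ) ≤ (binomSums (n - 1)).card := Nat.cast_nonneg _
  have hs : (((n - 1).sqrt : ℕ) : ℝ) ≤ x :=
    (Real.nat_sqrt_le_real_sqrt).trans (Real.sqrt_le_sqrt (by exact_mod_cast Nat.sub_le n 1))
  by_cases hA : 6 * (n - 1).sqrt + 3 ≤ n - 1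
  · obtain ⟨A, hA'⟩ := Nat.exists_eq_add_of_le hA
    have h1 := choose_le_card_binomSums (m := n - 1) (A := A) (by omega)
    have h1' : (((A + 1).choose 2 : ℕ) : ℝ) ≤ (binomSums (n - 1)).card := by exact_mod_cast h1
    rw [Nat.cast_choose_two] at h1'
    push_cast at h1'
    have h2 : (n : ℝ) = 6 * ((n - 1).sqrt : ℕ) + 3 + A + 1 := by
      exact_mod_cast (by omega : n = 6 * (n - 1).sqrt + 3 + A + 1)
    have h3 : x ^ 2 - 10 * x ≤ A := by
      rw [hx2, h2]
      linarith
    -- for `x ≤ 10` the left-hand side of the claim is not positive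
    by_cases h4 : x ≤ 10
    · nlinarith [pow_pos (by linarith : 0 < x) 3]
    · have h5 : (x ^ 2 - 10 * x) ^ 2 ≤ (A : ℝ) ^ 2 :=
        pow_le_pow_left₀ (by nlinarith) h3 2
      have h6 : (0 : ℝ) ≤ A := Nat.cast_nonneg _
      nlinarith
  · have h2 : (n : ℝ) ≤ 6 * ((n - 1).sqrt : ℕ) + 4 := by
      exact_mod_cast (by omega : n ≤ 6 * (n - 1).sqrt + 4)
    have h3 : x ^ 2 ≤ 10 * x := by
      rw [hx2]
      linarith
    nlinarith [mul_nonneg (sub_nonneg.2 h3) (sq_nonneg x), pow_pos (by linarith : 0 < x) 3]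

/-! ### The group action on polynomials -/

section Polynomials

open MvPolynomial GenSymm

instance finite_genSymmGroup (n k : ℕ) [NeZero k] : Finite (genSymmGroup n k) := by
  have hS : ({z : ℂ | z = 0 ∨ z ^ k = 1}).Finite := by
    refine (Set.finite_singleton (0 : ℂ)).union ?_
    refine (Polynomial.nthRootsFinset k (1 : ℂ)).finite_toSet.subset fun z hz => ?_
    exact (Polynomial.mem_nthRootsFinset (NeZero.pos k) 1).2 hz
  have := hS.to_subtype
  refine Finite.of_injective (β := Fin n → Fin n → {z : ℂ | z = 0 ∨ z ^ k = 1})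
    (fun g i j => ⟨(g : Matrix.GeneralLinearGroup (Fin n) ℂ) i j, ?_⟩) ?_
  · by_cases h : (g : Matrix.GeneralLinearGroup (Fin n) ℂ) i j = 0
    · exact Or.inl h
    · exact Or.inr (g.2.root i j h)
  · intro g g' h
    ext i j
    exact congrArg Subtype.val (congrFun (congrFun h i) j)

/-- The monomial matrix `e_j ↦ z_j e_{σ j}` as an element of the generalised symmetric group. -/
theorem exists_natRep_single {n k : ℕ} [NeZero k] (σ : Equiv.Perm (Fin n)) (z : Fin n → ℂ)
    (hz : ∀ j, z j ^ k = 1) :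
    ∃ g : genSymmGroup n k, ∀ j,
      natRep n k g (Pi.single j 1) = z j • (Pi.single (σ j) 1 : Fin n → ℂ) := by
  have hz0 : ∀ j, z j ≠ 0 := by
    intro j h
    have := hz j
    rw [h, zero_pow (NeZero.ne k)] at this
    exact zero_ne_one this
  let A : Matrix (Fin n) (Fin n) ℂ := fun i j => if i = σ j then z j else 0
  let B : Matrix (Fin n) (Fin n) ℂ := fun i j => if j = σ i then (z i)⁻¹ else 0
  have hBA : B * A = 1 := by
    ext i j
    rw [Matrix.mul_apply, Finset.sum_eq_single (σ i)]
    · by_cases hij : i = j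
      · subst hij
        simp [A, B, hz0]
      · simp [A, B, hij]
    · intro l _ hl
      simp [B, hl]
    · simp
  let u : Matrix.GeneralLinearGroup (Fin n) ℂ := ⟨A, B, mul_eq_one_comm.1 hBA, hBA⟩
  have hA : ∀ i j, A i j ≠ 0 ↔ i = σ j := by
    intro i j
    by_cases h : i = σ j
    · simp [A, h, hz0]
    · simp [A, h]
  have hu : u ∈ genSymmGroup n k := by
    refine ⟨fun i j h => ?_, fun i => ⟨σ.symm i, ?_, fun j hj => ?_⟩,
      fun j => ⟨σ j, ?_, fun i hi => ?_⟩⟩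
    · change A i j ^ k = 1
      have h' := (hA i j).1 h
      simp only [A, h', if_true, hz]
    · exact (hA _ _).2 (by simp)
    · rw [(hA _ _).1 hj, Equiv.symm_apply_apply]
    · exact (hA _ _).2 rfl
    · exact (hA _ _).1 hi
  refine ⟨⟨u, hu⟩, fun j => ?_⟩
  change A.mulVec (Pi.single j 1) = _
  ext i
  rw [Matrix.mulVec_single_one]
  change (if i = σ j then z j else 0) = _
  by_cases h : i = σ j
  · simp [h]
  · simp [h]

/-- The substitution `X_j ↦ z_j X_{σ j}`: the action of a monomial matrix on polynomials. -/
noncomputable def monAct {n : ℕ} (σ : Equiv.Perm (Fin n)) (z : Fin n → ℂ) :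
    MvPolynomial (Fin n) ℂ →ₐ[ℂ] MvPolynomial (Fin n) ℂ :=
  aeval fun j => z j • X (σ j)

section MonAct

variable {n : ℕ} (σ : Equiv.Perm (Fin n)) (z : Fin n → ℂ)

theorem monAct_monomial (β : Fin n →₀ ℕ) (c : ℂ) :
    monAct σ z (monomial β c) = monomial (β.mapDomain σ) (c * ∏ j, z j ^ β j) := by
  have h1 : monomial (β.mapDomain σ) (1 : ℂ) = ∏ j, X (σ j) ^ β j := by
    rw [monomial_eq, C_1, one_mul, Finsupp.prod_mapDomain_index_inj σ.injective,
      Finsupp.prod_fintype _ _ (by simp)]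
  have h2 : monomial (β.mapDomain σ) (c * ∏ j, z j ^ β j)
      = (c * ∏ j, z j ^ β j) • monomial (β.mapDomain σ) (1 : ℂ) := by
    rw [smul_monomial, smul_eq_mul, mul_one]
  rw [monAct, aeval_monomial, Finsupp.prod_fintype _ _ (by simp), h2, h1]
  simp only [Algebra.smul_def, mul_pow, map_mul, map_prod, map_pow, Finset.prod_mul_distrib]
  ring

theorem coeff_monAct (β : Fin n →₀ ℕ) (p : MvPolynomial (Fin n) ℂ) :
    coeff (β.mapDomain σ) (monAct σ z p) = (∏ j, z j ^ β j) * coeff β p := by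
  induction p using MvPolynomial.induction_on' with
  | monomial γ c =>
    rw [monAct_monomial, coeff_monomial, coeff_monomial]
    by_cases h : γ = β
    · subst h
      simp [mul_comm]
    · rw [if_neg h, if_neg fun h' => h (Finsupp.mapDomain_injective σ.injective h'), mul_zero]
  | add p q hp hq => rw [map_add, coeff_add, hp, hq, coeff_add, mul_add]

end MonAct

/-- The symmetric algebra of `ℂ^n` as the polynomial ring, the basis vector `e_j` being the
variable `X_j`. -/
noncomputable def symEquiv (n : ℕ) :
    SymmetricAlgebra ℂ (Fin n → ℂ) ≃ₐ[ℂ] MvPolynomial (Fin n) ℂ :=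
  SymmetricAlgebra.equivMvPolynomial (Pi.basisFun ℂ (Fin n))

theorem symEquiv_ι_single {n : ℕ} (j : Fin n) :
    symEquiv n (SymmetricAlgebra.ι ℂ _ (Pi.single j 1)) = X j := by
  have := SymmetricAlgebra.equivMvPolynomial_ι_apply (Pi.basisFun ℂ (Fin n)) j
  rwa [Pi.basisFun_apply] at this

/-- Under `symEquiv`, a linear map that acts on the basis as a monomial matrix acts by
`monAct`. -/
theorem symEquiv_symMap {n : ℕ} {f : (Fin n → ℂ) →ₗ[ℂ] (Fin n → ℂ)} {σ : Equiv.Perm (Fin n)}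
    {z : Fin n → ℂ} (hf : ∀ j, f (Pi.single j 1) = z j • (Pi.single (σ j) 1 : Fin n → ℂ))
    (x : SymmetricAlgebra ℂ (Fin n → ℂ)) :
    symEquiv n (symMap f x) = monAct σ z (symEquiv n x) := by
  have : (symEquiv n).toAlgHom.comp (symMap f) = (monAct σ z).comp (symEquiv n).toAlgHom := by
    apply SymmetricAlgebra.algHom_ext
    refine (Pi.basisFun ℂ (Fin n)).ext fun j => ?_
    simp [symMap_ι, hf, symEquiv_ι_single, monAct]
  exact DFunLike.congr_fun this x

/-- The symmetric powers are the spaces of homogeneous polynomials. -/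
theorem map_symPow (n r : ℕ) :
    (symPow (Fin n → ℂ) r).map (symEquiv n).toLinearMap = homogeneousSubmodule (Fin n) ℂ r := by
  have h1 : (LinearMap.range (SymmetricAlgebra.ι ℂ (Fin n → ℂ))).map (symEquiv n).toLinearMap
      = homogeneousSubmodule (Fin n) ℂ 1 := by
    rw [homogeneousSubmodule_one_eq_span_X, ← LinearMap.range_comp, ← Submodule.map_top,
      ← (Pi.basisFun ℂ (Fin n)).span_eq, Submodule.map_span]
    congr 1
    rw [← Set.range_comp]
    congr 1
    ext1 j
    simp [symEquiv_ι_single]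
  rw [symPow]
  change Submodule.map ((symEquiv n).toAlgHom.toLinearMap) _ = _
  rw [Submodule.map_pow]
  change ((LinearMap.range (SymmetricAlgebra.ι ℂ (Fin n → ℂ))).map (symEquiv n).toLinearMap) ^ r = _
  rw [h1, homogeneousSubmodule_one_pow]

instance finite_symPow (n r : ℕ) : Module.Finite ℂ (symPow (Fin n → ℂ) r) := by
  rw [Module.Finite.iff_fg, symPow]
  exact Submodule.FG.pow (Module.Finite.iff_fg.1 inferInstance) r

/-! ### Eigenvectors of least degree -/

section Antisymmetrised

variable {n : ℕ} {γ : Type*} [DecidableEq γ]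

/-- The permutations of the coordinates that preserve the colouring `c`. -/
def colourPerms (c : Fin n → γ) : Finset (Equiv.Perm (Fin n)) :=
  Finset.univ.filter fun σ => ∀ i, c (σ i) = c i

/-- The antisymmetrisation of the monomial `X ^ α` over the permutations that preserve the
colouring `c`. -/
noncomputable def antisymmMonomial (c : Fin n → γ) (α : Fin n →₀ ℕ) : MvPolynomial (Fin n) ℂ :=
  ∑ σ ∈ colourPerms c, monomial (α.mapDomain σ) ((Equiv.Perm.sign σ : ℤ) : ℂ)

variable {c : Fin n → γ} {α : Fin n →₀ ℕ}

theorem isHomogeneous_antisymm : (antisymmMonomial c α).IsHomogeneous (∑ i, α i) := by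
  refine IsHomogeneous.sum _ _ _ fun σ _ => isHomogeneous_monomial _ ?_
  rw [Finsupp.degree_eq_sum, ← Equiv.sum_comp σ]
  simp [Finsupp.mapDomain_apply σ.injective]

theorem antisymm_ne_zero (h : ∀ i j, c i = c j → α i = α j → i = j) : antisymmMonomial c α ≠ 0 := by
  intro h0
  have h1 : coeff α (antisymmMonomial c α) = 1 := by
    rw [antisymmMonomial, coeff_sum, Finset.sum_eq_single 1]
    · simp [Finsupp.mapDomain_id]
    · intro σ hσ hne
      rw [coeff_monomial, if_neg]
      intro heq
      refine hne (Equiv.ext fun i => h _ _ ((Finset.mem_filter.1 hσ).2 i) ?_)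
      conv_lhs => rw [← heq]
      exact Finsupp.mapDomain_apply σ.injective _ _
    · intro hne
      exact absurd (Finset.mem_filter.2 ⟨Finset.mem_univ _, fun _ => rfl⟩) hne
  rw [h0, coeff_zero] at h1
  exact zero_ne_one h1

theorem monAct_swap_antisymm {i j : Fin n} (hij : i ≠ j) (hc : c i = c j) :
    monAct (Equiv.swap i j) 1 (antisymmMonomial c α) = (-1 : ℂ) • antisymmMonomial c α := by
  rw [antisymmMonomial, map_sum, Finset.smul_sum]
  have hmem : ∀ σ ∈ colourPerms c, Equiv.swap i j * σ ∈ colourPerms c := by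
    intro σ hσ
    refine Finset.mem_filter.2 ⟨Finset.mem_univ _, fun x => ?_⟩
    rw [← (Finset.mem_filter.1 hσ).2 x, Equiv.Perm.mul_apply, Equiv.swap_apply_def]
    split_ifs with h1 h2
    · rw [h1, hc]
    · rw [h2, hc]
    · rfl
  refine Finset.sum_bij' (fun σ _ => Equiv.swap i j * σ) (fun σ _ => Equiv.swap i j * σ)
    hmem hmem (by simp [← mul_assoc]) (by simp [← mul_assoc]) fun σ _ => ?_
  rw [monAct_monomial, ← Finsupp.mapDomain_comp, smul_monomial]
  simp [Equiv.Perm.sign_swap hij, Equiv.Perm.coe_mul]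

theorem monAct_diag_antisymm {k : ℕ} {z : Fin n → ℂ} (hz : ∀ i, z i ^ k = 1)
    (h : ∀ i j, c i = c j → α i ≡ α j [MOD k]) :
    monAct 1 z (antisymmMonomial c α) = (∏ i, z i ^ α i) • antisymmMonomial c α := by
  rw [antisymmMonomial, map_sum, Finset.smul_sum]
  refine Finset.sum_congr rfl fun σ hσ => ?_
  rw [monAct_monomial, smul_monomial, smul_eq_mul, mul_comm]
  refine congrArg₂ (fun β a => monomial β a) Finsupp.mapDomain_id ?_
  · congr 1
    refine Finset.prod_congr rfl fun i _ => ?_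
    have h1 : α.mapDomain σ i = α (σ.symm i) := by
      conv_lhs => rw [← σ.apply_symm_apply i]
      exact Finsupp.mapDomain_apply σ.injective _ _
    have h2 : c (σ.symm i) = c i := by
      rw [← (Finset.mem_filter.1 hσ).2 (σ.symm i), Equiv.apply_symm_apply]
    rw [h1]
    exact pow_eq_pow_of_modEq (h _ _ h2) (hz i)

end Antisymmetrised

/-- If `α` has the least degree among the exponents that are congruent to `α` modulo `k` and
injective on each colour class, then the antisymmetrisation of `X ^ α` has an eigencharacter that
does not occur in lower degree: the diagonal matrices force congruence modulo `k`, the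
transpositions force injectivity on the classes. -/
theorem exists_functional_of_colouring {n k : ℕ} [NeZero k] {γ : Type*} [DecidableEq γ]
    (c : Fin n → γ) (α : Fin n →₀ ℕ) (hinj : ∀ i j, c i = c j → α i = α j → i = j)
    (hmod : ∀ i j, c i = c j → α i ≡ α j [MOD k])
    (hmin : ∀ β : Fin n → ℕ, (∀ i, β i ≡ α i [MOD k]) →
      (∀ i j, c i = c j → β i = β j → i = j) → ∑ i, α i ≤ ∑ i, β i) :
    ∃ ℓ : (genSymmGroup n k → ℂ) →ₗ[ℂ] ℂ,
      (∀ s < ∑ i, α i, ℓ (chi n k s) = 0) ∧ ℓ (chi n k (∑ i, α i)) ≠ 0 := by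
  have hv0 : (symEquiv n).symm (antisymmMonomial c α) ∈ symPow (Fin n → ℂ) (∑ i, α i) := by
    have : antisymmMonomial c α ∈ (symPow (Fin n → ℂ) (∑ i, α i)).map (symEquiv n).toLinearMap := by
      rw [map_symPow]
      exact isHomogeneous_antisymm
    obtain ⟨x, hx, hx'⟩ := this
    rw [← hx']
    change (symEquiv n).symm (symEquiv n x) ∈ _
    rwa [AlgEquiv.symm_apply_apply]
  refine exists_functional_of_eigenvector (W := fun s => symPow (Fin n → ℂ) s)
    (fun s => symPowRep (natRep n k) s) _ ⟨_, hv0⟩ ?_ ?_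
  · intro h
    have h' := congrArg Subtype.val h
    exact antisymm_ne_zero hinj ((map_eq_zero_iff _ (symEquiv n).symm.injective).1 h')
  · intro s hs w hw
    set p := symEquiv n (w : SymmetricAlgebra ℂ (Fin n → ℂ)) with hp
    have hp_hom : p.IsHomogeneous s := by
      have : p ∈ (symPow (Fin n → ℂ) s).map (symEquiv n).toLinearMap :=
        Submodule.mem_map_of_mem w.2
      rwa [map_symPow] at this
    have key : ∀ (σ : Equiv.Perm (Fin n)) (z : Fin n → ℂ) (d : ℂ), (∀ i, z i ^ k = 1) →
        monAct σ z (antisymmMonomial c α) = d • antisymmMonomial c α → monAct σ z p = d • p := by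
      intro σ z d hz hd
      obtain ⟨g, hg⟩ := exists_natRep_single σ z hz
      have h1 := hw g d (Subtype.ext ?_)
      · rw [hp, ← symEquiv_symMap hg, ← map_smul]
        exact congrArg (symEquiv n) (congrArg Subtype.val h1)
      · change symMap (natRep n k g) ((symEquiv n).symm (antisymmMonomial c α))
          = d • (symEquiv n).symm (antisymmMonomial c α)
        apply (symEquiv n).injective
        rw [symEquiv_symMap hg, AlgEquiv.apply_symm_apply, hd, map_smul,
          AlgEquiv.apply_symm_apply]
    suffices hp0 : p = 0 by
      exact Subtype.ext ((map_eq_zero_iff _ (symEquiv n).injective).1 hp0)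
    ext β
    rw [coeff_zero]
    by_contra hβ
    have hdeg : ∑ i, β i = s := by
      rw [← Finsupp.degree_eq_sum]
      by_contra hne
      exact hβ (hp_hom.coeff_eq_zero hne)
    refine absurd (hmin β (fun i => ?_) fun i j hc hij => ?_) (by omega)
    · -- the diagonal matrix with a primitive root in place `i` compares `β i` with `α i`
      have hζ := Complex.isPrimitiveRoot_exp k (NeZero.ne k)
      set ζ := Complex.exp (2 * Real.pi * Complex.I / k)
      have hz : ∀ j, (Function.update (1 : Fin n → ℂ) i ζ) j ^ k = 1 := by
        intro j
        by_cases hj : j = i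
        · subst hj
          simpa using hζ.pow_eq_one
        · simp [hj]
      have hprod : ∀ δ : Fin n →₀ ℕ,
          ∏ j, (Function.update (1 : Fin n → ℂ) i ζ) j ^ δ j = ζ ^ δ i := by
        intro δ
        rw [Finset.prod_eq_single i]
        · simp
        · intro j _ hj
          simp [hj]
        · simp
      have h1 := key 1 _ _ hz (monAct_diag_antisymm hz hmod)
      have h2 := coeff_monAct 1 (Function.update (1 : Fin n → ℂ) i ζ) β p
      rw [h1, hprod, hprod, show β.mapDomain (1 : Equiv.Perm (Fin n)) = β from
        Finsupp.mapDomain_id, coeff_smul, smul_eq_mul] at h2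
      have h3 := mul_right_cancel₀ hβ h2
      have hk := NeZero.pos k
      refine hζ.pow_inj (Nat.mod_lt _ hk) (Nat.mod_lt _ hk) ?_
      rw [pow_eq_pow_of_modEq (Nat.mod_modEq _ _) hζ.pow_eq_one, ← h3,
        pow_eq_pow_of_modEq (Nat.mod_modEq _ _) hζ.pow_eq_one]
    · -- if `β i = β j`, the transposition fixes `X ^ β` but negates its coefficient
      by_contra hne
      have h1 := key (Equiv.swap i j) 1 (-1) (by simp) (monAct_swap_antisymm hne hc)
      have h2 := coeff_monAct (Equiv.swap i j) 1 β p
      have h3 : β.mapDomain (Equiv.swap i j) = β := by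
        ext x
        conv_lhs => rw [← Equiv.swap_apply_self i j x]
        rw [Finsupp.mapDomain_apply (Equiv.swap i j).injective, Equiv.swap_apply_def]
        split_ifs with hx hx'
        · rw [hx, hij]
        · rw [hx', hij]
        · rfl
      rw [h1, h3, coeff_smul] at h2
      simp only [Pi.one_apply, one_pow, Finset.prod_const_one, one_mul, neg_smul, one_smul] at h2
      exact hβ (self_eq_neg.1 h2.symm)

theorem sum_range_card_le_sum (s : Finset ℕ) : ∑ i ∈ Finset.range s.card, i ≤ ∑ i ∈ s, i := by
  induction s using Finset.induction_on_max with
  | empty => simp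
  | insert a s hs ih =>
    have ha : a ∉ s := fun h => lt_irrefl _ (hs a h)
    have hcard : s.card ≤ a := by
      simpa using Finset.card_le_card fun x hx => Finset.mem_range.2 (hs x hx)
    rw [Finset.card_insert_of_notMem ha, Finset.sum_insert ha, Finset.sum_range_succ, add_comm]
    exact add_le_add hcard ih

theorem sum_fin_val_le_sum_of_injective {l : ℕ} (f : Fin l → ℕ) (hf : Function.Injective f) :
    ∑ i : Fin l, (i : ℕ) ≤ ∑ i, f i := by
  have := sum_range_card_le_sum (Finset.univ.map ⟨f, hf⟩)
  rwa [Finset.card_map, Finset.card_univ, Fintype.card_fin, Finset.sum_map,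
    ← Fin.sum_univ_eq_sum_range (fun i => i) l] at this

theorem sum_fin_val (l : ℕ) : ∑ i : Fin l, (i : ℕ) = l.choose 2 := by
  rw [Fin.sum_univ_eq_sum_range (fun i => i) l, Finset.sum_range_id, Nat.choose_two_right]

/-- For a partition `(l b)` of `n - 1` and a residue `s < k`, the character `χ_r` with
`r = k ∑ C(l b, 2) + s` is separated from its predecessors. The eigenvector behind it is the
product of the Vandermonde determinants of the `x_i ^ k` over the blocks of the partition, times
the `s`-th power of the remaining variable. -/
theorem exists_functional_of_partition {n k s : ℕ} [NeZero k] (hs : s < k) {B : Type*} [Fintype B]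
    [DecidableEq B] (l : B → ℕ) (hl : ∑ b, l b + 1 = n) :
    ∃ ℓ : (genSymmGroup n k → ℂ) →ₗ[ℂ] ℂ,
      (∀ r < k * ∑ b, (l b).choose 2 + s, ℓ (chi n k r) = 0) ∧
        ℓ (chi n k (k * ∑ b, (l b).choose 2 + s)) ≠ 0 := by
  -- `none` indexes the remaining variable, `some ⟨b, i⟩` the `i`-th variable of the block `b`
  let e : Option (Σ b, Fin (l b)) ≃ Fin n := Fintype.equivFinOfCardEq (by simpa using hl)
  let a : Option (Σ b, Fin (l b)) → ℕ := fun o => o.elim s fun x => k * x.2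
  let α : Fin n →₀ ℕ := Finsupp.equivFunOnFinite.symm (a ∘ e.symm)
  let c : Fin n → Option B := fun i => (e.symm i).map Sigma.fst
  have hα : ∀ i, α i = a (e.symm i) := fun i => rfl
  have hsum : ∑ i, α i = k * ∑ b, (l b).choose 2 + s := by
    simp only [hα]
    rw [e.symm.sum_comp a, Fintype.sum_option, Fintype.sum_sigma, add_comm, Finset.mul_sum]
    simp only [a, Option.elim, ← Finset.mul_sum, sum_fin_val]
  rw [← hsum]
  refine exists_functional_of_colouring c α ?_ ?_ ?_
  · intro i j
    obtain ⟨i, rfl⟩ := e.surjective i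
    obtain ⟨j, rfl⟩ := e.surjective j
    rcases i with _ | ⟨b, i⟩ <;> rcases j with _ | ⟨b', j⟩ <;>
      simp only [c, hα, a, Equiv.symm_apply_apply, Option.map_none, Option.map_some, Option.elim,
        reduceCtorEq, IsEmpty.forall_iff, implies_true, Option.some.injEq]
    rintro rfl h
    rw [Fin.ext (Nat.eq_of_mul_eq_mul_left (NeZero.pos k) h)]
  · intro i j
    obtain ⟨i, rfl⟩ := e.surjective i
    obtain ⟨j, rfl⟩ := e.surjective j
    rcases i with _ | ⟨b, i⟩ <;> rcases j with _ | ⟨b', j⟩ <;>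
      simp only [c, hα, a, Equiv.symm_apply_apply, Option.map_none, Option.map_some, Option.elim,
        reduceCtorEq, IsEmpty.forall_iff, Option.some.injEq]
    · exact fun _ => rfl
    · exact fun _ => (Nat.modEq_zero_iff_dvd.2 ⟨_, rfl⟩).trans
        (Nat.modEq_zero_iff_dvd.2 ⟨_, rfl⟩).symm
  · intro β hβ hinj
    rw [hsum, ← e.sum_comp β, Fintype.sum_option, Fintype.sum_sigma, add_comm, Finset.mul_sum]
    refine add_le_add ?_ (Finset.sum_le_sum fun b _ => ?_)
    · have h1 := hβ (e none)
      simp only [hα, Equiv.symm_apply_apply, a, Option.elim] at h1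
      rw [Nat.ModEq, Nat.mod_eq_of_lt hs] at h1
      rw [← h1]
      exact Nat.mod_le _ _
    · have hd : ∀ i : Fin (l b), k ∣ β (e (some ⟨b, i⟩)) := by
        intro i
        have h1 := hβ (e (some ⟨b, i⟩))
        simp only [hα, Equiv.symm_apply_apply, a, Option.elim] at h1
        exact Nat.modEq_zero_iff_dvd.1 (h1.trans (Nat.modEq_zero_iff_dvd.2 ⟨_, rfl⟩))
      choose g hg using hd
      simp only [hg, ← Finset.mul_sum]
      rw [← sum_fin_val]
      refine Nat.mul_le_mul_left k (sum_fin_val_le_sum_of_injective g fun i j hij => ?_)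
      have h1 := hinj (e (some ⟨b, i⟩)) (e (some ⟨b, j⟩)) (by simp [c]) (by rw [hg, hg, hij])
      simpa using h1

/-! ### The bounds for the dimension -/

/-- The degrees `k v + s`, with `v` a binomial sum for `n - 1` and `s < k`, are distinct, and the
characters in these degrees are linearly independent. -/
theorem mul_card_binomSums_le_D {n k : ℕ} (hn : 1 ≤ n) (hk : 1 ≤ k) :
    k * (binomSums (n - 1)).card ≤ D n k := by
  have : NeZero k := ⟨by omega⟩
  let f : ℕ × ℕ → ℕ := fun p => k * p.1 + p.2
  have hf : Set.InjOn f (binomSums (n - 1) ×ˢ Finset.range k : Finset (ℕ × ℕ)) := by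
    rintro ⟨v, s⟩ h ⟨v', s'⟩ h' heq
    have hs : s < k := Finset.mem_range.1 (Finset.mem_product.1 (Finset.mem_coe.1 h)).2
    have hs' : s' < k := Finset.mem_range.1 (Finset.mem_product.1 (Finset.mem_coe.1 h')).2
    have h1 := congrArg (· / k) heq
    have h2 := congrArg (· % k) heq
    simp only [f, Nat.mul_add_mod, Nat.mod_eq_of_lt hs, Nat.mod_eq_of_lt hs',
      Nat.mul_add_div (NeZero.pos k), Nat.div_eq_of_lt hs, Nat.div_eq_of_lt hs', add_zero] at h1 h2
    rw [h1, h2]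
  have hcard : ((binomSums (n - 1) ×ˢ Finset.range k).image f).card
      = k * (binomSums (n - 1)).card := by
    rw [Finset.card_image_of_injOn hf, Finset.card_product, Finset.card_range, mul_comm]
  rw [← hcard, D]
  refine card_le_finrank_span_of_functionals _ _ fun r hr => ?_
  obtain ⟨⟨v, s⟩, hvs, rfl⟩ := Finset.mem_image.1 hr
  obtain ⟨hv, hs⟩ := Finset.mem_product.1 hvs
  obtain ⟨a, b, w, hm, hv'⟩ := isBinomSum_of_mem hv
  dsimp only at hv'
  obtain ⟨t, ht⟩ := Nat.exists_eq_add_of_le hm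
  have hl := exists_functional_of_partition (n := n) (Finset.mem_range.1 hs)
    (Sum.elim ![a, b] (Sum.elim (fun _ : Fin w => 2) fun _ : Fin t => 1)) (by simp; omega)
  have hsum : ∑ x, (Sum.elim ![a, b] (Sum.elim (fun _ : Fin w => 2) fun _ : Fin t => 1) x).choose 2
      = v := by
    simp [hv']
  rwa [hsum] at hl

end Polynomials

theorem proposition4 :
    ∃ c : ℝ, 0 < c ∧ ∀ n k : ℕ, 2 ≤ n → 1 ≤ k →
      max ((n : ℝ) ^ 2 / 2 - c * (n : ℝ) ^ (3 / 2 : ℝ))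
          ((k : ℝ) * (((n : ℝ) - 1) * Real.log ((n : ℝ) - 1) - 2 * ((n : ℝ) - 2)))
        ≤ (GenSymm.D n k : ℝ) := by
  refine ⟨10, by norm_num, fun n k hn hk => ?_⟩
  have hD : (k : ℝ) * (binomSums (n - 1)).card ≤ GenSymm.D n k := by
    exact_mod_cast mul_card_binomSums_le_D (by omega) hk
  have hk' : (1 : ℝ) ≤ k := by exact_mod_cast hk
  refine max_le ?_ ?_
  · refine (sq_bound_le_card_binomSums hn).trans (le_trans ?_ hD)
    exact le_mul_of_one_le_left (Nat.cast_nonneg _) hk'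
  · refine le_trans (mul_le_mul_of_nonneg_left ?_ (by linarith)) hD
    have h1 := log_bound_le_card_binomSums (m := n - 1) (by omega)
    rw [Nat.cast_sub (by omega), Nat.cast_one] at h1
    linarith
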